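/- Let $\Omega\subseteq\mathbb R^D$ be open and let $\phi=(\phi_1,\dots,\phi_d):\Omega\to\mathbb R^d$ be infinitely smooth. Let $\mathbb W_\phi=\mathrm{span}_{\mathbb R}\{\nabla\phi_1,\dots,\nabla\phi_d\}\subseteq \mathcal C^\infty(\Omega,\mathbb R^D)$, and let $\mathrm{Lie}(\mathbb W_\phi)$ be the smallest linear subspace of $\mathcal C^\infty(\Omega,\mathbb R^D)$ that contains $\mathbb W_\phi$ and is stable under the Lie bracket $[X,Y](\theta)=\partial Y(\theta)X(\theta)-\partial X(\theta)Y(\theta)$. For a set $W$ of vector fields on $\Omega$, its trace at $\theta\in\Omega$ is $W(\theta)=\mathrm{span}\{X(\theta):X\in W\}$. One says that $\phi$ has the Frobenius property on $\Omega$ if $\mathrm{Lie}(\mathbb W_\phi)(\theta)=\mathbb W_\phi(\theta)$ for all $\theta\in\Omega$. A conservation law for $\phi$ on an open set $U\subseteq\Omega$ is a function $h\in\mathcal C^1(U,\mathbb R)$ with $\partial\phi(\theta)\nabla h(\theta)=0$ for all $\theta\in U$. Consider the following statements. (i) $\phi$ has the Frobenius property on $\Omega$, and $\dim \mathbb W_\phi(\theta)$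 is constant for $\theta\in\Omega$. (ii) For every $\theta_0\in\Omega$ there are an open neighborhood $U\subseteq\Omega$ of $\theta_0$, an integer $N\ge 0$ and $\mathbf h=(h_1,\dots,h_N):U\to\mathbb R^N$ whose coordinates are conservation laws for $\phi$ on $U$, such that $\ker\partial\phi(\theta)\cap\ker\partial\mathbf h(\theta)=\{0\}$ for every $\theta\in U$ with $\mathbf h(\theta)=\mathbf h(\theta_0)$. (iii) $\phi$ has the Frobenius property on $\Omega$. Then (i) implies (ii), and (ii) implies (iii). -/

import Mathlib

open scoped ContDiff

/-- The Euclidean space `ℝⁿ`. -/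
abbrev EucSp (n : ℕ) : Type := EuclideanSpace ℝ (Fin n)

/-- The vector fields that are infinitely smooth on `Ω`. A field is represented by a total function;
its values outside `Ω` play no role. -/
def smoothFields {D : ℕ} (Ω : Set (EucSp D)) : Submodule ℝ (EucSp D → EucSp D) where
  carrier := {X | ContDiffOn ℝ ∞ X Ω}
  add_mem' hX hY := ContDiffOn.add hX hY
  zero_mem' := contDiffOn_const
  smul_mem' c _ hX := ContDiffOn.const_smul c hX

/-- A linear space of vector fields is stable under the Lie bracket
`[X, Y](θ) = ∂Y(θ) X(θ) - ∂X(θ) Y(θ)`. -/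
def IsBracketStable {D : ℕ} (S : Submodule ℝ (EucSp D → EucSp D)) : Prop :=
  ∀ X ∈ S, ∀ Y ∈ S, VectorField.lieBracket ℝ X Y ∈ S

/-- On an open set, the smooth vector fields are themselves stable under brackets, so that the
family of subspaces in `generatedLieAlgebra` below is not empty. -/
theorem isBracketStable_smoothFields {D : ℕ} {Ω : Set (EucSp D)} (hΩ : IsOpen Ω) :
    IsBracketStable (smoothFields Ω) := by
  intro X hX Y hY
  have hX' : ContDiffOn ℝ ∞ X Ω := hX
  have hY' : ContDiffOn ℝ ∞ Y Ω := hY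
  have h1 : ContDiffOn ℝ ∞ (fderiv ℝ Y) Ω := hY'.fderiv_of_isOpen hΩ (by simp)
  have h2 : ContDiffOn ℝ ∞ (fderiv ℝ X) Ω := hX'.fderiv_of_isOpen hΩ (by simp)
  exact (h1.clm_apply hX').sub (h2.clm_apply hY')

/-- The Lie algebra on `Ω` generated by a set `W` of vector fields: the smallest linear space of
smooth vector fields on `Ω` that contains `W` and is stable under Lie brackets. -/
def generatedLieAlgebra {D : ℕ} (Ω : Set (EucSp D)) (W : Set (EucSp D → EucSp D)) :
    Submodule ℝ (EucSp D → EucSp D) :=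
  sInf {S | W ⊆ S ∧ S ≤ smoothFields Ω ∧ IsBracketStable S}

/-- The trace at `θ` of a set `W` of vector fields. -/
def fieldTrace {D : ℕ} (W : Set (EucSp D → EucSp D)) (θ : EucSp D) : Submodule ℝ (EucSp D) :=
  Submodule.span ℝ ((fun X => X θ) '' W)

/-- `W_φ`, the real span of the gradient fields `∇φ₁, …, ∇φ_d`. -/
noncomputable def gradientSpan {D d : ℕ} (φ : EucSp D → EucSp d) :
    Submodule ℝ (EucSp D → EucSp D) :=
  Submodule.span ℝ (Set.range fun i : Fin d => gradient fun θ => φ θ i)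

/-- The Frobenius property of `φ` (smooth on `Ω`) on the open set `Ω`. -/
def FrobeniusProperty {D d : ℕ} (φ : EucSp D → EucSp d) (Ω : Set (EucSp D)) : Prop :=
  ∀ θ ∈ Ω, fieldTrace (generatedLieAlgebra Ω (gradientSpan φ : Set (EucSp D → EucSp D))) θ
    = fieldTrace (gradientSpan φ : Set (EucSp D → EucSp D)) θ

/-- The trace of `W_φ` has constant dimension on `Ω`. -/
def ConstantTraceDimension {D d : ℕ} (φ : EucSp D → EucSp d) (Ω : Set (EucSp D)) : Prop :=
  ∃ r : ℕ, ∀ θ ∈ Ω,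
    Module.finrank ℝ (fieldTrace (gradientSpan φ : Set (EucSp D → EucSp D)) θ) = r

/-- `h` is a conservation law for `φ` on the open set `U`: it is `C¹` on `U` and
`∂φ(θ) ∇h(θ) = 0` for all `θ ∈ U`. -/
def IsConservationLaw {D d : ℕ} (φ : EucSp D → EucSp d) (U : Set (EucSp D))
    (h : EucSp D → ℝ) : Prop :=
  ContDiffOn ℝ 1 h U ∧ ∀ θ ∈ U, fderiv ℝ φ θ (gradient h θ) = 0

/-- Around every `θ₀ ∈ Ω` there are finitely many conservation laws `h = (h₁, …, h_N)` on an open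
neighbourhood `U ⊆ Ω` with `ker ∂φ(θ) ∩ ker ∂h(θ) = {0}` at all points `θ` of the level set of
`h` through `θ₀` in `U`. -/
def HasKernelTrivializingLaws {D d : ℕ} (φ : EucSp D → EucSp d) (Ω : Set (EucSp D)) : Prop :=
  ∀ θ₀ ∈ Ω, ∃ U : Set (EucSp D), IsOpen U ∧ θ₀ ∈ U ∧ U ⊆ Ω ∧
    ∃ (N : ℕ) (h : EucSp D → EucSp N),
      (∀ j : Fin N, IsConservationLaw φ U fun θ => h θ j) ∧
      ∀ θ ∈ U, h θ = h θ₀ →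
        LinearMap.ker (fderiv ℝ φ θ : EucSp D →ₗ[ℝ] EucSp d) ⊓
          LinearMap.ker (fderiv ℝ h θ : EucSp D →ₗ[ℝ] EucSp N) = ⊥

/-! (ii) implies (iii): a conservation law is exactly a function killed by every `∇φᵢ`. The fields
killing all components of `h` on `U` form a bracket-stable space, so it contains the whole generated
Lie algebra. Split a value `X(θ₀)` of that algebra as `w + w'`, with `w` in the trace of the
gradients and `w'` orthogonal to it, that is, `w' ∈ ker ∂φ(θ₀)`. Both `X(θ₀)` and `w` lie in `ker
∂h(θ₀)`, hence so does `w'`, and the kernel condition gives `w' = 0`. Because `h` is only `C¹`,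
bracket stability cannot come from second derivatives of `h`; `fderiv_lieBracket_eq_zero` obtains it
from the invariance of `h` under the flow of one of the fields.

(i) implies (ii): this is the Frobenius theorem. With constant rank the gradient trace has a local
frame `B` normalized by `P ∘ B = id`, where `P` is a fixed projection. Brackets of frame fields lie
in the range of `B` by involutivity and are killed by `P`, so they vanish
(`exists_commuting_frame`). Flowing a transversal along commuting fields gives coordinates, and the
transversal coordinates are first integrals whose differential has kernel exactly the trace
(`exists_firstIntegrals`). The trace meets `ker ∂φ` only in zero, by orthogonality.

Both halves need flows that are `C¹` in the initial data and parameters. These come from the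
implicit function theorem in the Banach space `C(I, E)`. -/

/-! ### Differentiability of composition operators on spaces of continuous maps -/

section PathSpace

open Set Filter Topology

variable {K G H : Type*} [TopologicalSpace K] [CompactSpace K]
  [NormedAddCommGroup G] [NormedSpace ℝ G] [NormedAddCommGroup H] [NormedSpace ℝ H]

/-- Pointwise application of a continuous family of operators to a continuous family of vectors. -/
noncomputable def pointwiseApply :
    C(K, G →L[ℝ] H) →L[ℝ] C(K, G) →L[ℝ] C(K, H) :=
  LinearMap.mkContinuous₂
    (LinearMap.mk₂ ℝ (fun (A : C(K, G →L[ℝ] H)) (g : C(K, G)) =>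
      (⟨fun t => A t (g t), A.continuous.clm_apply g.continuous⟩ : C(K, H)))
      (fun _ _ _ => by ext; simp) (fun _ _ _ => by ext; simp)
      (fun _ _ _ => by ext; simp) (fun _ _ _ => by ext; simp)) 1 (by
    intro A g
    rw [one_mul]
    refine (ContinuousMap.norm_le _ (mul_nonneg (norm_nonneg A) (norm_nonneg g))).2 fun t => ?_
    exact (ContinuousLinearMap.le_opNorm _ _).trans
      (mul_le_mul (A.norm_coe_le_norm t) (g.norm_coe_le_norm t) (norm_nonneg _) (norm_nonneg _)))

@[simp]
theorem pointwiseApply_apply (A : C(K, G →L[ℝ] H)) (g : C(K, G)) (t : K) :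
    pointwiseApply A g t = A t (g t) := rfl

/-- The derivative of a continuously differentiable map, as a continuous map. -/
noncomputable def fderivMap (φ : G → H) (hφ : ContDiff ℝ 1 φ) : C(G, G →L[ℝ] H) :=
  ⟨fderiv ℝ φ, hφ.continuous_fderiv one_ne_zero⟩

@[simp]
theorem fderivMap_apply (φ : G → H) (hφ : ContDiff ℝ 1 φ) (x : G) :
    fderivMap φ hφ x = fderiv ℝ φ x := rfl

/-- Composition with a `C¹` map is differentiable on the space of continuous maps. -/
theorem hasFDerivAt_postcomp (φ : C(G, H)) (hφ : ContDiff ℝ 1 φ) (y : C(K, G)) :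
    HasFDerivAt (fun z : C(K, G) => φ.comp z) (pointwiseApply ((fderivMap φ hφ).comp y)) y := by
  refine HasFDerivAt.of_isLittleO (Asymptotics.isLittleO_iff.2 fun c hc => ?_)
  have hcont : Continuous fun z : C(K, G) => (fderivMap φ hφ).comp z :=
    (fderivMap φ hφ).continuous_postcomp
  obtain ⟨r, hr, hyr⟩ := Metric.continuous_iff (α := C(K, G)) (β := C(K, G →L[ℝ] H)) |>.1 hcont y c hc
  filter_upwards [Metric.ball_mem_nhds y hr] with z hz
  rw [ContinuousMap.norm_le _ (by positivity)]
  intro t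
  have hball : ∀ x ∈ Metric.ball (y t) r, ‖fderiv ℝ φ x - fderiv ℝ φ (y t)‖ ≤ c := by
    intro x hx
    -- Shifting `y` by a constant reaches any `x` near `y t` while staying within `r` of `y` in the
    -- sup norm. The radius `r` therefore serves all `t` at once.
    have hd : dist (y + ContinuousMap.const K (x - y t)) y < r := by
      rw [dist_eq_norm, add_sub_cancel_left, ContinuousMap.norm_lt_iff _ hr]
      intro s
      simpa [dist_eq_norm] using hx
    have h1 := (ContinuousMap.norm_coe_le_norm _ t).trans
      ((dist_eq_norm _ _).symm.trans_lt (hyr _ hd)).le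
    simpa using h1
  have hzt : z t ∈ Metric.ball (y t) r :=
    Metric.mem_ball.2 ((ContinuousMap.dist_apply_le_dist t).trans_lt hz)
  have h2 := (convex_ball (y t) r).norm_image_sub_le_of_norm_hasFDerivWithin_le'
    (f := φ) (f' := fderiv ℝ φ) (φ := fderiv ℝ φ (y t))
    (fun x _ => ((hφ.differentiable one_ne_zero) x).hasFDerivAt.hasFDerivWithinAt)
    hball (Metric.mem_ball_self hr) hzt
  refine h2.trans (mul_le_mul_of_nonneg_left ?_ hc.le)
  exact ContinuousMap.norm_coe_le_norm (z - y) t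

theorem contDiff_postcomp (φ : C(G, H)) (hφ : ContDiff ℝ 1 φ) :
    ContDiff ℝ 1 (fun z : C(K, G) => φ.comp z) := by
  rw [contDiff_one_iff_fderiv]
  refine ⟨fun y => (hasFDerivAt_postcomp φ hφ y).differentiableAt, ?_⟩
  have : fderiv ℝ (fun z : C(K, G) => φ.comp z)
      = fun y => pointwiseApply ((fderivMap φ hφ).comp y) :=
    funext fun y => (hasFDerivAt_postcomp φ hφ y).fderiv
  rw [this]
  exact pointwiseApply.continuous.comp ((fderivMap φ hφ).continuous_postcomp)

end PathSpace

/-! ### Integration as a bounded operator on paths -/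

section Primitive

open Set Filter Topology unitInterval

variable {E : Type*} [NormedAddCommGroup E] [NormedSpace ℝ E]

/-- The primitive of a path, as a function on the whole line. -/
noncomputable def pathPrimitiveFun (g : C(I, E)) (t : ℝ) : E :=
  ∫ s in (0 : ℝ)..t, g.IccExtend zero_le_one s

theorem hasDerivAt_pathPrimitiveFun [CompleteSpace E] (g : C(I, E)) (t : ℝ) :
    HasDerivAt (pathPrimitiveFun g) (g.IccExtend zero_le_one t) t :=
  intervalIntegral.integral_hasDerivAt_right
    ((g.IccExtend zero_le_one).continuous.intervalIntegrable _ _)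
    ((g.IccExtend zero_le_one).continuous.stronglyMeasurableAtFilter _ _)
    (g.IccExtend zero_le_one).continuous.continuousAt

/-- Integration of paths from time zero on. -/
noncomputable def pathPrimitive [CompleteSpace E] : C(I, E) →L[ℝ] C(I, E) :=
  LinearMap.mkContinuous
    { toFun := fun g => ⟨fun t => pathPrimitiveFun g t,
        (continuous_iff_continuousAt.2 fun t =>
          (hasDerivAt_pathPrimitiveFun g t).continuousAt).comp continuous_subtype_val⟩
      map_add' := fun f g => by
        ext t
        exact intervalIntegral.integral_add
          ((f.IccExtend zero_le_one).continuous.intervalIntegrable _ _)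
          ((g.IccExtend zero_le_one).continuous.intervalIntegrable _ _)
      map_smul' := fun c f => by
        ext t
        exact intervalIntegral.integral_smul c _ } 1 (by
    intro g
    rw [one_mul, ContinuousMap.norm_le _ (norm_nonneg _)]
    intro t
    have h := intervalIntegral.norm_integral_le_of_norm_le_const (a := 0) (b := (t : ℝ))
      (C := ‖g‖) (f := g.IccExtend zero_le_one) (fun x _ => g.norm_coe_le_norm _)
    refine h.trans ?_
    rw [sub_zero, abs_of_nonneg t.2.1]
    exact mul_le_of_le_one_right (norm_nonneg _) t.2.2)

theorem pathPrimitive_apply [CompleteSpace E] (g : C(I, E)) (t : I) :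
    pathPrimitive g t = pathPrimitiveFun g t := rfl

theorem pathPrimitiveFun_zero (g : C(I, E)) : pathPrimitiveFun g 0 = 0 := by
  simp [pathPrimitiveFun]

theorem pathPrimitive_const [CompleteSpace E] (x : E) (t : I) :
    pathPrimitive (ContinuousMap.const I x) t = (t : ℝ) • x := by
  have h : ∀ s : ℝ, (ContinuousMap.const I x).IccExtend zero_le_one s = x := fun _ => rfl
  simp [pathPrimitive_apply, pathPrimitiveFun, h]

end Primitive

/-! ### Solutions with `C¹` dependence on parameters -/

section Flow

open Set Filter Topology unitInterval

variable {V E : Type*} [NormedAddCommGroup V] [NormedSpace ℝ V]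
  [NormedAddCommGroup E] [NormedSpace ℝ E]

/-- The path `t ↦ (p.1, y t)` as a function of the parameter `p` and the path `y`. -/
noncomputable def pathWithParameter : (V × E) × C(I, E) →L[ℝ] C(I, V × E) :=
  ((ContinuousLinearMap.inl ℝ V E).compLeftContinuous ℝ I).comp
      ((ContinuousLinearMap.const ℝ I).comp
        ((ContinuousLinearMap.fst ℝ V E).comp (ContinuousLinearMap.fst ℝ (V × E) C(I, E)))) +
    ((ContinuousLinearMap.inr ℝ V E).compLeftContinuous ℝ I).comp
      (ContinuousLinearMap.snd ℝ (V × E) C(I, E))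

@[simp]
theorem pathWithParameter_apply (q : (V × E) × C(I, E)) (t : I) :
    pathWithParameter q t = (q.1.1, q.2 t) := by
  simp [pathWithParameter]

/-- `Y p` is, for `p = (v, x)` near `p₀`, the solution on `[0, 1]` of `y' = f (v, y)`, `y 0 = x`;
it depends differentiably on `p`, and its derivative solves the linearized equation. -/
structure IsSolutionFamily [CompleteSpace E] (f : V × E → E) (hf : ContDiff ℝ 1 f) (p₀ : V × E)
    (Y : V × E → C(I, E)) : Prop where
  contDiffAt : ContDiffAt ℝ 1 Y p₀
  base : Y p₀ = ContinuousMap.const I p₀.2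
  eventually_eq : ∀ᶠ p in 𝓝 p₀, Y p = ContinuousMap.const I p.2 +
    pathPrimitive (ContinuousMap.comp ⟨f, hf.continuous⟩ (pathWithParameter (p, Y p)))
  eventually_differentiableAt : ∀ᶠ p in 𝓝 p₀, DifferentiableAt ℝ Y p
  eventually_fderiv : ∀ᶠ p in 𝓝 p₀, ∀ q, fderiv ℝ Y p q = ContinuousMap.const I q.2 +
    pathPrimitive (pointwiseApply ((fderivMap f hf).comp (pathWithParameter (p, Y p)))
      (pathWithParameter (q, fderiv ℝ Y p q)))

/-- The map whose zeros `((v, x), y)` are the solutions `y` of `y' = f (v, y)`, `y 0 = x`. -/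
noncomputable def solutionDefect [CompleteSpace E] (f : V × E → E) (hf : ContDiff ℝ 1 f)
    (q : (V × E) × C(I, E)) : C(I, E) :=
  q.2 - (ContinuousLinearMap.const ℝ I q.1.2 +
    pathPrimitive (ContinuousMap.comp ⟨f, hf.continuous⟩ (pathWithParameter q)))

/-- The derivative of the integral operator defining the solutions of `y' = f (v, y)`. -/
noncomputable def linearizedIntegral [CompleteSpace E] (f : V × E → E) (hf : ContDiff ℝ 1 f)
    (u : (V × E) × C(I, E)) : (V × E) × C(I, E) →L[ℝ] C(I, E) :=
  ((ContinuousLinearMap.const ℝ I).comp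
      ((ContinuousLinearMap.snd ℝ V E).comp (ContinuousLinearMap.fst ℝ (V × E) C(I, E)))) +
    pathPrimitive.comp ((pointwiseApply ((fderivMap f hf).comp (pathWithParameter u))).comp
      pathWithParameter)

theorem linearizedIntegral_apply [CompleteSpace E] (f : V × E → E) (hf : ContDiff ℝ 1 f)
    (u q : (V × E) × C(I, E)) :
    linearizedIntegral f hf u q = ContinuousMap.const I q.1.2 +
      pathPrimitive (pointwiseApply ((fderivMap f hf).comp (pathWithParameter u))
        (pathWithParameter q)) := rfl

theorem contDiff_solutionDefect [CompleteSpace E] (f : V × E → E) (hf : ContDiff ℝ 1 f) :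
    ContDiff ℝ 1 (solutionDefect f hf) := by
  have hN : ContDiff ℝ 1 fun z : C(I, V × E) => ContinuousMap.comp ⟨f, hf.continuous⟩ z :=
    contDiff_postcomp ⟨f, hf.continuous⟩ hf
  have h1 : ContDiff ℝ 1 fun q : (V × E) × C(I, E) =>
      pathPrimitive (ContinuousMap.comp ⟨f, hf.continuous⟩ (pathWithParameter q)) :=
    pathPrimitive.contDiff.comp (hN.comp pathWithParameter.contDiff)
  have h2 : ContDiff ℝ 1 fun q : (V × E) × C(I, E) => ContinuousLinearMap.const ℝ I q.1.2 :=
    ((ContinuousLinearMap.const ℝ I).comp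
      ((ContinuousLinearMap.snd ℝ V E).comp (ContinuousLinearMap.fst ℝ (V × E) C(I, E)))).contDiff
  exact contDiff_snd.sub (h2.add h1)

theorem hasFDerivAt_integral [CompleteSpace E] (f : V × E → E) (hf : ContDiff ℝ 1 f)
    (u : (V × E) × C(I, E)) :
    HasFDerivAt (fun q : (V × E) × C(I, E) => ContinuousLinearMap.const ℝ I q.1.2 +
      pathPrimitive (ContinuousMap.comp ⟨f, hf.continuous⟩ (pathWithParameter q)))
      (linearizedIntegral f hf u) u := by
  have hN := hasFDerivAt_postcomp (K := I) ⟨f, hf.continuous⟩ hf (pathWithParameter u)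
  have hL : HasFDerivAt (pathWithParameter (V := V) (E := E)) pathWithParameter u :=
    ContinuousLinearMap.hasFDerivAt _
  have hP (g : C(I, E)) : HasFDerivAt (pathPrimitive (E := E)) pathPrimitive g :=
    ContinuousLinearMap.hasFDerivAt _
  have h1 : HasFDerivAt (fun q : (V × E) × C(I, E) =>
      pathPrimitive (ContinuousMap.comp ⟨f, hf.continuous⟩ (pathWithParameter q)))
      (pathPrimitive.comp ((pointwiseApply ((fderivMap f hf).comp (pathWithParameter u))).comp
        pathWithParameter)) u :=
    (hP _).comp u (hN.comp u hL)
  have h2 : HasFDerivAt (fun q : (V × E) × C(I, E) => ContinuousLinearMap.const ℝ I q.1.2)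
      ((ContinuousLinearMap.const ℝ I).comp
      ((ContinuousLinearMap.snd ℝ V E).comp (ContinuousLinearMap.fst ℝ (V × E) C(I, E)))) u :=
    ((ContinuousLinearMap.const ℝ I).comp
      ((ContinuousLinearMap.snd ℝ V E).comp (ContinuousLinearMap.fst ℝ (V × E) C(I, E)))).hasFDerivAt
  exact h2.add h1

theorem fderiv_snd_eq_zero {f : V × E → E} (hf : ContDiff ℝ 1 f) (h0 : ∀ x, f (0, x) = 0)
    (x y : E) : fderiv ℝ f (0, x) (0, y) = 0 := by
  have h1 : HasFDerivAt (fun z : E => f (0, z))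
      ((fderiv ℝ f (0, x)).comp (ContinuousLinearMap.inr ℝ V E)) x :=
    ((hf.differentiable one_ne_zero) (0, x)).hasFDerivAt.comp x
      (hasFDerivAt_prodMk_right (0 : V) x)
  have h2 : (fun z : E => f (0, z)) = fun _ => 0 := funext h0
  rw [h2] at h1
  have h3 := h1.unique (hasFDerivAt_const (0 : E) x)
  simpa using congrArg (fun A : E →L[ℝ] E => A y) h3

/-- In the path direction the derivative is the identity minus an integral of `∂f/∂x`, and this
integrand vanishes at `v = 0` because `f (0, ·) = 0`. -/
theorem fderiv_solutionDefect_inr [CompleteSpace E] {f : V × E → E} (hf : ContDiff ℝ 1 f)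
    (h0 : ∀ x, f (0, x) = 0) (x₀ : E) :
    (fderiv ℝ (solutionDefect f hf) ((0, x₀), ContinuousMap.const I x₀) ∘L
      .inr ℝ (V × E) C(I, E)) = ContinuousLinearMap.id ℝ C(I, E) := by
  have h1 : HasFDerivAt (solutionDefect f hf) _ ((0, x₀), ContinuousMap.const I x₀) :=
    hasFDerivAt_snd.sub (hasFDerivAt_integral f hf _)
  rw [h1.fderiv]
  refine ContinuousLinearMap.ext fun δ => ?_
  have h2 : pointwiseApply ((fderivMap f hf).comp
      (pathWithParameter (((0 : V), x₀), ContinuousMap.const I x₀)))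
      (pathWithParameter ((0 : V × E), δ)) = 0 := by
    ext t
    simp [fderiv_snd_eq_zero hf h0]
  have h3 : linearizedIntegral f hf (((0 : V), x₀), ContinuousMap.const I x₀) (0, δ) = 0 := by
    rw [linearizedIntegral_apply, h2, map_zero, add_zero]
    rfl
  change δ - linearizedIntegral f hf (((0 : V), x₀), ContinuousMap.const I x₀) (0, δ) = δ
  rw [h3, sub_zero]

theorem solutionDefect_base [CompleteSpace E] {f : V × E → E} (hf : ContDiff ℝ 1 f)
    (h0 : ∀ x, f (0, x) = 0) (x₀ : E) :
    solutionDefect f hf ((0, x₀), ContinuousMap.const I x₀) = 0 := by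
  have h1 : ContinuousMap.comp ⟨f, hf.continuous⟩
      (pathWithParameter (((0 : V), x₀), ContinuousMap.const I x₀)) = 0 := by
    ext t
    simp [h0]
  rw [solutionDefect, h1, map_zero, add_zero]
  exact sub_self _

/-- At `v = 0` the constant path is a solution, and the partial derivative of the defect there is
invertible, so the implicit function theorem applies. Small `v` takes the place of short time, which
allows the fixed interval `[0, 1]`. The linearized equation is the derivative of the integral
equation. -/
theorem exists_isSolutionFamily [CompleteSpace V] [CompleteSpace E] (f : V × E → E)
    (hf : ContDiff ℝ 1 f) (h0 : ∀ x, f (0, x) = 0) (x₀ : E) :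
    ∃ Y, IsSolutionFamily f hf (0, x₀) Y := by
  have hif : (fderiv ℝ (solutionDefect f hf) (((0 : V), x₀), ContinuousMap.const I x₀) ∘L
      .inr ℝ (V × E) C(I, E)).IsInvertible := by
    rw [fderiv_solutionDefect_inr hf h0]
    exact ⟨ContinuousLinearEquiv.refl ℝ _, rfl⟩
  have hFat : ContDiffAt ℝ 1 (solutionDefect f hf) (((0 : V), x₀), ContinuousMap.const I x₀) :=
    (contDiff_solutionDefect f hf).contDiffAt
  obtain ⟨Y, hY1, hY0, hYe⟩ : ∃ Y : V × E → C(I, E), ContDiffAt ℝ 1 Y (0, x₀) ∧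
      Y (0, x₀) = ContinuousMap.const I x₀ ∧
      ∀ᶠ p in 𝓝 ((0 : V), x₀), solutionDefect f hf (p, Y p) =
        solutionDefect f hf (((0 : V), x₀), ContinuousMap.const I x₀) :=
    ⟨_, hFat.contDiffAt_implicitFunction one_ne_zero hif,
      hFat.implicitFunction_apply_self one_ne_zero hif,
      hFat.eventually_apply_implicitFunction one_ne_zero hif⟩
  have hYe' : ∀ᶠ p in 𝓝 ((0 : V), x₀), Y p = ContinuousMap.const I p.2 +
      pathPrimitive (ContinuousMap.comp ⟨f, hf.continuous⟩ (pathWithParameter (p, Y p))) := by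
    filter_upwards [hYe] with p hp
    rw [solutionDefect_base hf h0] at hp
    exact sub_eq_zero.1 hp
  have hYd : ∀ᶠ p in 𝓝 ((0 : V), x₀), DifferentiableAt ℝ Y p :=
    (hY1.eventually (by simp)).mono fun p hp => hp.differentiableAt one_ne_zero
  refine ⟨Y, hY1, hY0, hYe', hYd, ?_⟩
  filter_upwards [hYe'.eventually_nhds, hYd] with p hp hd q
  have h1 := (hasFDerivAt_integral f hf (p, Y p)).comp p
    ((hasFDerivAt_id p).prodMk hd.hasFDerivAt)
  have h2 := (h1.congr_of_eventuallyEq hp).fderiv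
  exact congrArg (fun A : V × E →L[ℝ] C(I, E) => A q) h2

end Flow

/-! ### Derivatives of the flow for fields linear in the parameter -/

section FirstIntegrals

open Set Filter Topology unitInterval

variable {V E : Type*} [NormedAddCommGroup V] [NormedSpace ℝ V]
  [NormedAddCommGroup E] [NormedSpace ℝ E]

/-- Extending the integrand by its end values gives two-sided derivatives at the endpoints of `[0,
1]` too. -/
theorem exists_hasDerivAt_extension [CompleteSpace E] {y g : C(I, E)} {x : E}
    (h : y = ContinuousMap.const I x + pathPrimitive g) :
    ∃ z : ℝ → E, z 0 = x ∧ (∀ t : I, z t = y t) ∧ ∀ t : I, HasDerivAt z (g t) t := by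
  refine ⟨fun t => x + pathPrimitiveFun g t, by simp [pathPrimitiveFun_zero], fun t => ?_,
    fun t => ?_⟩
  · rw [h]
    rfl
  · have h1 := (hasDerivAt_pathPrimitiveFun g t).const_add x
    have h2 : g.IccExtend zero_le_one (t : ℝ) = g t :=
      congrArg g (projIcc_val zero_le_one t)
    rwa [h2] at h1

theorem hasFDerivAt_uncurry_apply {B : E → V →L[ℝ] E} (hB : ContDiff ℝ 1 B) (v : V) (x : E) :
    HasFDerivAt (fun q : V × E => B q.2 q.1)
      ((B x).comp (ContinuousLinearMap.fst ℝ V E) +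
        ((fderiv ℝ B x).comp (ContinuousLinearMap.snd ℝ V E)).flip v) (v, x) :=
  HasFDerivAt.clm_apply (𝕜 := ℝ) (c := fun q : V × E => B q.2) (u := fun q : V × E => q.1)
    (x := (v, x)) (((hB.differentiable one_ne_zero) x).hasFDerivAt.comp (v, x) hasFDerivAt_snd)
    hasFDerivAt_fst

theorem fderiv_uncurry_apply {B : E → V →L[ℝ] E} (hB : ContDiff ℝ 1 B) (v w : V) (x δ : E) :
    fderiv ℝ (fun q : V × E => B q.2 q.1) (v, x) (w, δ) = B x w + fderiv ℝ B x δ v := by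
  rw [(hasFDerivAt_uncurry_apply hB v x).fderiv]
  simp

theorem contDiff_uncurry_apply {B : E → V →L[ℝ] E} (hB : ContDiff ℝ 1 B) :
    ContDiff ℝ 1 fun q : V × E => B q.2 q.1 :=
  (hB.comp contDiff_snd).clm_apply contDiff_fst

/-- The symmetry of `(v, w) ↦ ∂(B w)(x) (B x v)`: the fields `B v` commute at `x`. -/
def CommutesAt (B : E → V →L[ℝ] E) (x : E) : Prop :=
  ∀ v w, fderiv ℝ B x (B x v) w = fderiv ℝ B x (B x w) v

/-- A solution of a homogeneous linear equation that vanishes at time zero is zero. -/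
theorem eq_zero_of_linear_ode {z : ℝ → E} {A : C(I, E →L[ℝ] E)} (h0 : z 0 = 0)
    (hz : ∀ t : I, HasDerivAt z (A t (z t)) t) (t : I) : z t = 0 := by
  have hz' : ∀ t (ht : t ∈ Icc (0 : ℝ) 1), HasDerivAt z (A ⟨t, ht⟩ (z t)) t :=
    fun t ht => hz ⟨t, ht⟩
  refine eq_zero_of_abs_deriv_le_mul_abs_self_of_eq_zero_right (K := ‖A‖) (a := 0) (b := 1)
    (f' := fun s => A (projIcc 0 1 zero_le_one s) (z s))
    (fun s hs => (hz' s hs).continuousAt.continuousWithinAt) (fun s hs => ?_) h0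
    (fun s _ => ?_) t t.2
  · rw [projIcc_of_mem zero_le_one ⟨hs.1, hs.2.le⟩]
    exact (hz' s ⟨hs.1, hs.2.le⟩).hasDerivWithinAt
  · exact (ContinuousLinearMap.le_opNorm _ _).trans
      (mul_le_mul_of_nonneg_right (A.norm_coe_le_norm _) (norm_nonneg _))

/-- Continuity of `Y` in the sup norm keeps the entire path near the constant path at `p₀`. -/
theorem IsSolutionFamily.eventually_forall [CompleteSpace E] {f : V × E → E}
    {hf : ContDiff ℝ 1 f} {p₀ : V × E} {Y : V × E → C(I, E)} (hY : IsSolutionFamily f hf p₀ Y)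
    {P : E → Prop} (hP : ∀ᶠ x in 𝓝 p₀.2, P x) : ∀ᶠ p in 𝓝 p₀, ∀ t, P (Y p t) := by
  obtain ⟨r, hr, hball⟩ := Metric.eventually_nhds_iff.1 hP
  have hc : Tendsto Y (𝓝 p₀) (𝓝 (ContinuousMap.const I p₀.2)) := by
    have := hY.contDiffAt.continuousAt.tendsto
    rwa [hY.base] at this
  filter_upwards [hc (Metric.ball_mem_nhds _ hr)] with p hp t
  exact hball ((ContinuousMap.dist_apply_le_dist (g := ContinuousMap.const I p₀.2) t).trans_lt hp)

/-- Along solutions of `y' = B(y) v`, commuting fields `B w` give the derivative of the time one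
map with respect to `v`. -/
theorem IsSolutionFamily.eventually_fderiv_commuting [CompleteSpace E] {B : E → V →L[ℝ] E}
    (hB : ContDiff ℝ 1 B) {x₀ : E} {Y : V × E → C(I, E)}
    (hY : IsSolutionFamily _ (contDiff_uncurry_apply hB) (0, x₀) Y)
    (hcomm : ∀ᶠ x in 𝓝 x₀, CommutesAt B x) :
    ∀ᶠ p in 𝓝 (0, x₀), ∀ w, fderiv ℝ Y p (w, 0) 1 = B (Y p 1) w := by
  filter_upwards [hY.eventually_eq, hY.eventually_fderiv,
    hY.eventually_forall hcomm] with p hp hd hc w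
  obtain ⟨v, x⟩ := p
  obtain ⟨y, -, hyY, hy⟩ := exists_hasDerivAt_extension hp
  obtain ⟨u, hu0, huY, hu⟩ := exists_hasDerivAt_extension (hd (w, 0))
  have hy' : ∀ t : I, HasDerivAt y (B (Y (v, x) t) v) t := fun t => by simpa using hy t
  have hu' : ∀ t : I, HasDerivAt u
      (B (Y (v, x) t) w + fderiv ℝ B (Y (v, x) t) (u t) v) t := fun t => by
    have h1 := hu t
    rw [pointwiseApply_apply, ContinuousMap.comp_apply, fderivMap_apply, pathWithParameter_apply,
      pathWithParameter_apply, fderiv_uncurry_apply hB, ← huY] at h1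
    exact h1
  -- By commutation `s • B (y s) w` satisfies the same inhomogeneous linear equation as the
  -- variation `u`, with the same value zero at time zero. The difference then solves a homogeneous
  -- equation.
  have hBy : ∀ t : I, HasDerivAt (fun s => s • B (y s) w)
      (B (Y (v, x) t) w + (t : ℝ) • fderiv ℝ B (Y (v, x) t) (B (Y (v, x) t) v) w) t := fun t => by
    have h1 : HasFDerivAt B (fderiv ℝ B (Y (v, x) t)) (y t) := by
      rw [hyY]
      exact ((hB.differentiable one_ne_zero) _).hasFDerivAt
    have h2 : HasDerivAt (fun s => B (y s) w)
        (fderiv ℝ B (Y (v, x) t) (B (Y (v, x) t) v) w) t := by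
      simpa using (h1.comp_hasDerivAt (t : ℝ) (hy' t)).clm_apply (hasDerivAt_const (t : ℝ) w)
    have h3 := (hasDerivAt_id (t : ℝ)).smul h2
    rw [add_comm]
    have h4 : HasDerivAt (fun s => s • B (y s) w) _ (t : ℝ) := h3
    simpa [hyY] using h4
  have key := eq_zero_of_linear_ode (z := fun s => u s - s • B (y s) w)
    (A := ⟨fun t => (ContinuousLinearMap.apply ℝ E v).comp (fderiv ℝ B (Y (v, x) t)), by
      have h1 : Continuous fun t => fderiv ℝ B (Y (v, x) t) :=
        (hB.continuous_fderiv one_ne_zero).comp (Y (v, x)).continuous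
      exact continuous_const.clm_comp h1⟩)
    (by simp [hu0]) (fun t => by
      refine ((hu' t).fun_sub (hBy t)).congr_deriv ?_
      rw [hc t v w]
      simp only [ContinuousMap.coe_mk, ContinuousLinearMap.comp_apply, map_sub, map_smul,
        ContinuousLinearMap.apply_apply, hyY]
      abel) 1
  rw [← huY, ← hyY]
  have h1 : ((1 : I) : ℝ) = 1 := rfl
  rw [h1] at key ⊢
  simpa [sub_eq_zero] using key

/-- At `v = 0` the term with `fderiv ℝ B` drops out of the linearized equation, leaving the constant
right-hand side `B x₀ w`. -/
theorem IsSolutionFamily.fderiv_base [CompleteSpace E] {B : E → V →L[ℝ] E}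
    (hB : ContDiff ℝ 1 B) {x₀ : E} {Y : V × E → C(I, E)}
    (hY : IsSolutionFamily _ (contDiff_uncurry_apply hB) (0, x₀) Y) (w : V) (e : E) (t : I) :
    fderiv ℝ Y (0, x₀) (w, e) t = e + (t : ℝ) • B x₀ w := by
  have h1 := hY.eventually_fderiv.self_of_nhds (w, e)
  have h2 : pointwiseApply ((fderivMap _ (contDiff_uncurry_apply hB)).comp
      (pathWithParameter (((0 : V), x₀), Y (0, x₀))))
      (pathWithParameter ((w, e), fderiv ℝ Y (0, x₀) (w, e)))
      = ContinuousMap.const I (B x₀ w) := by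
    ext s
    rw [pointwiseApply_apply, ContinuousMap.comp_apply, fderivMap_apply, pathWithParameter_apply,
      pathWithParameter_apply, fderiv_uncurry_apply hB, hY.base]
    simp
  rw [h2] at h1
  rw [h1, ContinuousMap.add_apply, pathPrimitive_const]
  rfl

end FirstIntegrals

/-! ### First integrals of commuting fields -/

section FirstIntegrals

open Set Filter Topology unitInterval

variable {V E F K : Type*} [NormedAddCommGroup V] [NormedSpace ℝ V]
  [NormedAddCommGroup E] [NormedSpace ℝ E] [NormedAddCommGroup F] [NormedSpace ℝ F]
  [NormedAddCommGroup K] [NormedSpace ℝ K]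

/-- A map that is `C¹` at a point agrees near this point with a global `C¹` map. -/
theorem exists_contDiff_eventuallyEq [HasContDiffBump E] {f : E → F} {x₀ : E}
    (hf : ContDiffAt ℝ 1 f x₀) : ∃ g : E → F, ContDiff ℝ 1 g ∧ g =ᶠ[𝓝 x₀] f := by
  obtain ⟨r, hr, hball⟩ := Metric.eventually_nhds_iff.1 (hf.eventually (by simp))
  let χ : ContDiffBump x₀ := ⟨r / 4, r / 2, by positivity, by linarith⟩
  refine ⟨fun x => χ x • f x, contDiff_iff_contDiffAt.2 fun x => ?_, ?_⟩
  · by_cases hx : dist x x₀ < r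
    · exact χ.contDiffAt.smul (hball hx)
    · have h1 : (fun x => χ x • f x) =ᶠ[𝓝 x] fun _ => 0 := by
        have h2 : {z | r / 2 < dist z x₀} ∈ 𝓝 x :=
          (isOpen_lt continuous_const (continuous_id.dist continuous_const)).mem_nhds
            (show r / 2 < dist x x₀ by linarith)
        filter_upwards [h2] with z hz
        rw [χ.zero_of_le_dist (le_of_lt hz), zero_smul]
      exact contDiffAt_const.congr_of_eventuallyEq h1
  · filter_upwards [χ.eventuallyEq_one] with x hx
    rw [hx, Pi.one_apply, one_smul]

/-- A local form of the Frobenius theorem: if the fields `B v` commute near `x₀` and are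
linearly independent at `x₀`, they have a complete system of first integrals near `x₀`. -/
theorem exists_firstIntegrals [CompleteSpace V] [CompleteSpace E] [CompleteSpace K]
    [HasContDiffBump E] {B : E → V →L[ℝ] E} {x₀ : E}
    (hB : ContDiffAt ℝ 1 B x₀) (hcomm : ∀ᶠ x in 𝓝 x₀, CommutesAt B x)
    (e : (V × K) ≃L[ℝ] E) (he : ∀ v, e (v, 0) = B x₀ v) :
    ∃ h : E → K, ContDiffAt ℝ 1 h x₀ ∧ ∀ᶠ x in 𝓝 x₀, (∀ v, fderiv ℝ h x (B x v) = 0) ∧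
      ∀ u, fderiv ℝ h x u = 0 → ∃ v, u = B x v := by
  obtain ⟨B', hB', hBB'⟩ := exists_contDiff_eventuallyEq hB
  have hcomm' : ∀ᶠ x in 𝓝 x₀, CommutesAt B' x := by
    filter_upwards [hcomm, hBB'.eventually_nhds] with x hx hxB v w
    have h1 : B' =ᶠ[𝓝 x] B := hxB
    rw [h1.fderiv_eq, h1.eq_of_nhds]
    exact hx v w
  obtain ⟨Y, hY⟩ := exists_isSolutionFamily (fun q : V × E => B' q.2 q.1)
    (contDiff_uncurry_apply hB') (fun x => by simp) x₀
  -- Candidate coordinates: `G (v, k)` starts at the point `x₀ + e (0, k)` of the transversal and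
  -- follows `B' v` up to time one. Its derivative at the origin is `e`, so it is a local
  -- diffeomorphism with inverse `g`.
  let A : V × K →L[ℝ] V × E := (ContinuousLinearMap.id ℝ V).prodMap
    ((e : V × K →L[ℝ] E).comp (ContinuousLinearMap.inr ℝ V K))
  let a : V × K → V × E := fun q => (0, x₀) + A q
  have ha : ∀ q, HasFDerivAt a A q := fun q => A.hasFDerivAt.const_add _
  have ha0 : a 0 = (0, x₀) := by simp [a]
  let ev : C(I, E) →L[ℝ] E := ContinuousMap.evalCLM ℝ 1
  let G : V × K → E := fun q => ev (Y (a q))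
  have hG1 : ContDiffAt ℝ 1 G 0 := by
    have h1 : ContDiffAt ℝ 1 a 0 := contDiffAt_const.add A.contDiff.contDiffAt
    have h2 : ContDiffAt ℝ 1 Y (a 0) := by rw [ha0]; exact hY.contDiffAt
    exact ev.contDiff.contDiffAt.comp 0 (h2.comp 0 h1)
  have hGd : ∀ q, DifferentiableAt ℝ Y (a q) →
      HasFDerivAt G (ev.comp ((fderiv ℝ Y (a q)).comp A)) q := fun q hq =>
    ev.hasFDerivAt.comp q (hq.hasFDerivAt.comp q (ha q))
  have hG0 : HasFDerivAt G (e : V × K →L[ℝ] E) 0 := by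
    have h1 : DifferentiableAt ℝ Y (a 0) := by
      rw [ha0]
      exact hY.eventually_differentiableAt.self_of_nhds
    convert hGd 0 h1 using 1
    refine ContinuousLinearMap.ext fun q => ?_
    obtain ⟨v, k⟩ := q
    have h2 := hY.fderiv_base hB' v (e (0, k)) 1
    have h3 : (e (v, k) : E) = e (0, k) + B x₀ v := by
      rw [← he, ← map_add]
      simp
    rw [ha0]
    change e (v, k) = fderiv ℝ Y (0, x₀) (v, e (0, k)) 1
    rw [h2, h3, hBB'.eq_of_nhds]
    simp
  have hGs := hG1.hasStrictFDerivAt' hG0 one_ne_zero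
  have hGx : G 0 = x₀ := by
    change Y (a 0) 1 = x₀
    rw [ha0, hY.base]
    rfl
  let g : E → V × K := hG1.localInverse hG0 one_ne_zero
  have hg1 : ContDiffAt ℝ 1 g x₀ := hGx ▸ hG1.to_localInverse hG0 one_ne_zero
  have hg0 : g x₀ = 0 := by
    have := hG1.localInverse_apply_image hG0 one_ne_zero
    rwa [hGx] at this
  have hleft : ∀ᶠ q in 𝓝 (0 : V × K), g (G q) = q := hGs.eventually_left_inverse
  have hright : ∀ᶠ x in 𝓝 x₀, G (g x) = x := hGx ▸ hGs.eventually_right_inverse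
  have hgt : Tendsto g (𝓝 x₀) (𝓝 0) := hg0 ▸ hg1.continuousAt.tendsto
  have hat : Tendsto (fun x => a (g x)) (𝓝 x₀) (𝓝 (0, x₀)) := by
    have h1 := (ha 0).continuousAt.tendsto
    rw [ha0] at h1
    exact h1.comp hgt
  refine ⟨fun x => (g x).2, hg1.snd, ?_⟩
  filter_upwards [hright.eventually_nhds, hgt.eventually hleft.eventually_nhds, hBB',
    hat.eventually hY.eventually_differentiableAt,
    hat.eventually (hY.eventually_fderiv_commuting hB' hcomm'),
    (hg1.eventually (by simp)).mono fun x hx => hx.differentiableAt one_ne_zero]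
    with x hr hl hBx hYd hYc hgd
  have hGg : G (g x) = x := hr.self_of_nhds
  have hGx' := hGd (g x) hYd
  set DG := ev.comp ((fderiv ℝ Y (a (g x))).comp A) with hDG
  have h1 : (fderiv ℝ g x).comp DG = ContinuousLinearMap.id ℝ _ := by
    have h2 : HasFDerivAt g (fderiv ℝ g x) (G (g x)) := by rw [hGg]; exact hgd.hasFDerivAt
    exact ((h2.comp (g x) hGx').congr_of_eventuallyEq
      (hl.mono fun q hq => hq.symm)).unique (hasFDerivAt_id _)
  have h2 : DG.comp (fderiv ℝ g x) = ContinuousLinearMap.id ℝ _ :=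
    ((hGx'.comp x hgd.hasFDerivAt).congr_of_eventuallyEq
      (hr.mono fun q hq => hq.symm)).unique (hasFDerivAt_id _)
  -- Commutation enters here: in the coordinates `G` the fields `B v` become constant fields in the
  -- `V` directions, so the `K` component of `g` is a first integral.
  have h3 : ∀ v, DG (v, 0) = B x v := fun v => by
    have h4 := hYc v
    have h5 : Y (a (g x)) 1 = x := hGg
    rw [h5, hBx] at h4
    rw [← h4]
    have h6 : e ((0 : V), (0 : K)) = 0 := map_zero e
    simp [hDG, A, ev, h6]
  have h4 : fderiv ℝ (fun x => (g x).2) x =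
      (ContinuousLinearMap.snd ℝ V K).comp (fderiv ℝ g x) :=
    (hasFDerivAt_snd.comp x hgd.hasFDerivAt).fderiv
  rw [h4]
  refine ⟨fun v => ?_, fun u hu => ⟨(fderiv ℝ g x u).1, ?_⟩⟩
  · have h5 := congrArg (fun T : V × K →L[ℝ] V × K => T (v, 0)) h1
    simp only [ContinuousLinearMap.comp_apply, ContinuousLinearMap.id_apply, h3] at h5
    simp [h5]
  · have h5 := congrArg (fun T : E →L[ℝ] E => T u) h2
    have h6 : fderiv ℝ g x u = ((fderiv ℝ g x u).1, 0) := Prod.ext rfl hu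
    simp only [ContinuousLinearMap.comp_apply, ContinuousLinearMap.id_apply] at h5
    rw [h6, h3] at h5
    exact h5.symm

end FirstIntegrals

/-! ### Brackets of fields that annihilate a `C¹` function -/

section Bracket

open Set Filter Topology unitInterval

variable {E : Type*} [NormedAddCommGroup E] [NormedSpace ℝ E]

theorem continuous_comp_path {G H : Type*} [NormedAddCommGroup G] [NormedAddCommGroup H]
    (φ : C(G, H)) : Continuous fun z : C(I, G) => φ.comp z :=
  φ.continuous_postcomp

/-- Only continuity of `g` is needed; this replaces a mixed second derivative of the flow, which
need not exist as the flow is only known to be `C¹`. -/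
theorem hasDerivAt_smul_of_continuousAt {g : ℝ → E} (hg : ContinuousAt g 0) :
    HasDerivAt (fun τ => τ • g τ) (g 0) 0 := by
  rw [hasDerivAt_iff_tendsto_slope_zero]
  refine (hg.tendsto.mono_left nhdsWithin_le_nhds).congr' ?_
  filter_upwards [self_mem_nhdsWithin] with τ hτ
  simp [smul_smul, inv_mul_cancel₀ (show τ ≠ 0 from hτ)]

theorem tendsto_clm_apply {α G H : Type*} [NormedAddCommGroup G] [NormedSpace ℝ G]
    [NormedAddCommGroup H] [NormedSpace ℝ H] {l : Filter α} {A : α → G →L[ℝ] H} {x : α → G}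
    {A₀ : G →L[ℝ] H} {y₀ : G} (hA : Tendsto A l (𝓝 A₀)) (hx : Tendsto x l (𝓝 y₀)) :
    Tendsto (fun a => A a (x a)) l (𝓝 (A₀ y₀)) :=
  (isBoundedBilinearMap_apply.continuous.tendsto (A₀, y₀)).comp (hA.prodMk_nhds hx)

/-- If the derivatives of a `C¹` function along two `C¹` fields vanish, so does its derivative
along their bracket. The function need not be twice differentiable. -/
theorem fderiv_lieBracket_eq_zero [CompleteSpace E] [HasContDiffBump E] {X Z : E → E} {h : E → ℝ}
    {x₀ : E} (hX : ContDiffAt ℝ 1 X x₀) (hZ : ContDiffAt ℝ 1 Z x₀) (hh : ContDiffAt ℝ 1 h x₀)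
    (hhX : ∀ᶠ x in 𝓝 x₀, fderiv ℝ h x (X x) = 0) (hhZ : ∀ᶠ x in 𝓝 x₀, fderiv ℝ h x (Z x) = 0) :
    fderiv ℝ h x₀ (VectorField.lieBracket ℝ X Z x₀) = 0 := by
  obtain ⟨X', hX', hXX'⟩ := exists_contDiff_eventuallyEq hX
  have hhX' : ∀ᶠ x in 𝓝 x₀, fderiv ℝ h x (X' x) = 0 := by
    filter_upwards [hhX, hXX'] with x h1 h2
    rwa [h2]
  have hhd : ∀ᶠ x in 𝓝 x₀, DifferentiableAt ℝ h x :=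
    (hh.eventually (by simp)).mono fun x hx => hx.differentiableAt one_ne_zero
  let S : E →L[ℝ] ℝ →L[ℝ] E := ContinuousLinearMap.smulRightL ℝ ℝ E 1
  have hS : ∀ x τ, S x τ = τ • x := fun x τ => by simp [S]
  let B : E → ℝ →L[ℝ] E := fun x => S (X' x)
  have hB : ContDiff ℝ 1 B := S.contDiff.comp hX'
  have hBd : ∀ x δ τ, fderiv ℝ B x δ τ = τ • fderiv ℝ X' x δ := fun x δ τ => by
    have h1 : HasFDerivAt B (S.comp (fderiv ℝ X' x)) x :=
      S.hasFDerivAt.comp x ((hX'.differentiable one_ne_zero) x).hasFDerivAt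
    rw [h1.fderiv, ContinuousLinearMap.comp_apply, hS]
  obtain ⟨Y, hY⟩ := exists_isSolutionFamily (fun q : ℝ × E => B q.2 q.1)
    (contDiff_uncurry_apply hB) (fun x => by simp) x₀
  -- `h` is constant along the integral curves of `X'`.
  have hinv : ∀ᶠ p in 𝓝 ((0 : ℝ), x₀), h (Y p 1) = h p.2 := by
    filter_upwards [hY.eventually_eq, hY.eventually_forall (hhX'.and hhd)] with p hp hpY
    obtain ⟨y, hy0, hyY, hy⟩ := exists_hasDerivAt_extension hp
    have hy' : ∀ t (ht : t ∈ Icc (0 : ℝ) 1), HasDerivAt (fun s => h (y s)) 0 t := fun t ht => by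
      have h1 := hy ⟨t, ht⟩
      have h2 := (hpY ⟨t, ht⟩).2.hasFDerivAt
      have h3 := (hpY ⟨t, ht⟩).1
      rw [← hyY ⟨t, ht⟩] at h2 h3
      refine (h2.comp_hasDerivAt t h1).congr_deriv ?_
      simp [B, hS, ← hyY ⟨t, ht⟩, h3]
    have h1 := constant_of_has_deriv_right_zero
      (fun t ht => (hy' t ht).continuousAt.continuousWithinAt)
      (fun t ht => (hy' t ⟨ht.1, ht.2.le⟩).hasDerivWithinAt) 1 ⟨zero_le_one, le_rfl⟩
    rw [hy0] at h1
    rw [← hyY]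
    exact h1
  let ev : C(I, E) →L[ℝ] E := ContinuousMap.evalCLM ℝ 1
  let ι : ℝ → ℝ × E := fun τ => (τ, x₀)
  have hι : Tendsto ι (𝓝 0) (𝓝 (0, x₀)) :=
    (Continuous.prodMk_left x₀ : Continuous ι).tendsto 0
  let y : ℝ → E := fun τ => ev (Y (ι τ))
  -- The endpoint of `U τ` is `Z x₀` transported by the differential of the time `τ` flow. The
  -- linearized equation writes it as `Z x₀ + τ • g τ` with `g` continuous at zero.
  let U : ℝ → C(I, E) := fun τ => fderiv ℝ Y (ι τ) (0, Z x₀)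
  let g : ℝ → E := fun τ =>
    ev (pathPrimitive (pointwiseApply ((fderivMap X' hX').comp (Y (ι τ))) (U τ)))
  have hYc : Tendsto (fun τ => Y (ι τ)) (𝓝 0) (𝓝 (Y (0, x₀))) :=
    hY.contDiffAt.continuousAt.tendsto.comp hι
  have hUc : Tendsto U (𝓝 0) (𝓝 (U 0)) := by
    have h1 : ContinuousAt (fderiv ℝ Y) (0, x₀) :=
      (hY.contDiffAt.fderiv_right (m := 0) (by simp)).continuousAt
    exact ((ContinuousLinearMap.apply ℝ C(I, E) ((0 : ℝ), Z x₀)).continuous.tendsto _).comp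
      (h1.tendsto.comp hι)
  have hgc : ContinuousAt g 0 := by
    have h1 : Tendsto (fun τ => pointwiseApply ((fderivMap X' hX').comp (Y (ι τ)))) (𝓝 0)
        (𝓝 (pointwiseApply ((fderivMap X' hX').comp (Y (0, x₀))))) :=
      (pointwiseApply.continuous.tendsto _).comp
        (((continuous_comp_path (fderivMap X' hX')).tendsto _).comp hYc)
    exact ((ev.comp pathPrimitive).continuous.tendsto _).comp (tendsto_clm_apply h1 hUc)
  have hg0 : g 0 = fderiv ℝ X' x₀ (Z x₀) := by
    have h1 : pointwiseApply ((fderivMap X' hX').comp (Y (ι 0))) (U 0)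
        = ContinuousMap.const I (fderiv ℝ X' x₀ (Z x₀)) := by
      ext t
      have h2 := hY.fderiv_base hB 0 (Z x₀) t
      rw [map_zero, smul_zero, add_zero] at h2
      change fderiv ℝ X' (Y (0, x₀) t) (fderiv ℝ Y (0, x₀) (0, Z x₀) t) = _
      rw [h2, hY.base]
      rfl
    change pathPrimitive _ 1 = _
    rw [h1, pathPrimitive_const]
    simp
  have hUg : ∀ᶠ τ in 𝓝 (0 : ℝ), ev (U τ) = Z x₀ + τ • g τ := by
    filter_upwards [hι.eventually hY.eventually_fderiv] with τ hτ
    have h1 : U τ = _ := hτ (0, Z x₀)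
    have h2 : pointwiseApply ((fderivMap _ (contDiff_uncurry_apply hB)).comp
        (pathWithParameter (ι τ, Y (ι τ)))) (pathWithParameter ((0, Z x₀), U τ))
        = τ • pointwiseApply ((fderivMap X' hX').comp (Y (ι τ))) (U τ) := by
      ext t
      rw [pointwiseApply_apply, ContinuousMap.comp_apply, fderivMap_apply, pathWithParameter_apply,
        pathWithParameter_apply, fderiv_uncurry_apply hB, hBd]
      simp [ι]
    have h3 : U τ = ContinuousMap.const I (Z x₀) +
      τ • pathPrimitive (pointwiseApply ((fderivMap X' hX').comp (Y (ι τ))) (U τ)) := by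
      rw [← map_smul, ← h2]
      exact h1
    calc ev (U τ) = ev (ContinuousMap.const I (Z x₀) +
      τ • pathPrimitive (pointwiseApply ((fderivMap X' hX').comp (Y (ι τ))) (U τ))) :=
        congrArg ev h3
      _ = _ := by rw [map_add, map_smul]; rfl
  have hUd : HasDerivAt (fun τ => ev (U τ)) (fderiv ℝ X' x₀ (Z x₀)) 0 := by
    rw [← hg0]
    exact ((hasDerivAt_smul_of_continuousAt hgc).const_add (Z x₀)).congr_of_eventuallyEq hUg
  have hy0 : y 0 = x₀ := by
    change Y (0, x₀) 1 = x₀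
    rw [hY.base]
    rfl
  have hyd : HasDerivAt y (X' x₀) 0 := by
    have h1 : HasDerivAt ι (1, 0) 0 := (hasDerivAt_id (0 : ℝ)).prodMk (hasDerivAt_const _ _)
    have h2 : HasFDerivAt Y (fderiv ℝ Y (ι 0)) (ι 0) :=
      hY.eventually_differentiableAt.self_of_nhds.hasFDerivAt
    refine (ev.hasFDerivAt.comp_hasDerivAt 0 (h2.comp_hasDerivAt 0 h1)).congr_deriv ?_
    have h3 := hY.fderiv_base hB 1 0 1
    change fderiv ℝ Y (0, x₀) (1, 0) 1 = _
    rw [h3]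
    simp [B, hS]
  have hyt : Tendsto y (𝓝 0) (𝓝 x₀) := by
    have := hyd.continuousAt.tendsto
    rwa [hy0] at this
  -- Comparing `Z` along the integral curve with the transported vector gives the bracket as the
  -- derivative at zero.
  have hq : HasDerivAt (fun τ => Z (y τ) - ev (U τ))
      (fderiv ℝ Z x₀ (X' x₀) - fderiv ℝ X' x₀ (Z x₀)) 0 := by
    have h1 : HasFDerivAt Z (fderiv ℝ Z x₀) (y 0) := by
      rw [hy0]
      exact (hZ.differentiableAt one_ne_zero).hasFDerivAt
    exact (h1.comp_hasDerivAt 0 hyd).sub hUd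
  have hq0 : Z (y 0) - ev (U 0) = 0 := by
    rw [hUg.self_of_nhds, hy0]
    simp
  -- Differentiating the invariance of `h` in the initial point shows that `dh` kills the
  -- transported vector as well. Dividing by `τ` and letting `τ → 0` then uses only the continuity
  -- of `dh`.
  have hzero : ∀ᶠ τ in 𝓝 (0 : ℝ), fderiv ℝ h (y τ) (Z (y τ) - ev (U τ)) = 0 := by
    filter_upwards [hι.eventually hinv.eventually_nhds, hyt.eventually hhd, hyt.eventually hhZ,
      hι.eventually hY.eventually_differentiableAt] with τ h1 h2 h3 h4
    have h5 : HasFDerivAt (fun p => h (Y p 1))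
        ((fderiv ℝ h (y τ)).comp (ev.comp (fderiv ℝ Y (ι τ)))) (ι τ) :=
      h2.hasFDerivAt.comp (ι τ) (ev.hasFDerivAt.comp (ι τ) h4.hasFDerivAt)
    have h6 : HasFDerivAt (fun p : ℝ × E => h p.2)
        ((fderiv ℝ h x₀).comp (ContinuousLinearMap.snd ℝ ℝ E)) (ι τ) :=
      hhd.self_of_nhds.hasFDerivAt.comp (ι τ) hasFDerivAt_snd
    have h7 := congrArg (fun T : ℝ × E →L[ℝ] ℝ => T (0, Z x₀))
      ((h6.congr_of_eventuallyEq h1).unique h5)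
    have h8 : fderiv ℝ h x₀ (Z x₀) = fderiv ℝ h (y τ) (ev (U τ)) := h7
    rw [map_sub, h3, ← h8, hhZ.self_of_nhds, sub_zero]
  have hlim := (hasDerivAt_iff_tendsto_slope_zero.1 hq)
  have hhc : Tendsto (fun τ => fderiv ℝ h (y τ)) (𝓝[≠] 0) (𝓝 (fderiv ℝ h x₀)) :=
    ((hh.fderiv_right (m := 0) (by simp)).continuousAt.tendsto.comp hyt).mono_left
      nhdsWithin_le_nhds
  have h1 := tendsto_clm_apply hhc hlim
  have h2 : Tendsto (fun _ : ℝ => (0 : ℝ)) (𝓝[≠] 0)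
      (𝓝 (fderiv ℝ h x₀ (fderiv ℝ Z x₀ (X' x₀) - fderiv ℝ X' x₀ (Z x₀)))) := by
    refine h1.congr' ?_
    filter_upwards [nhdsWithin_le_nhds hzero] with τ hτ
    rw [zero_add, hq0, sub_zero, map_smul, hτ, smul_zero]
  have h3 := tendsto_nhds_unique h2 tendsto_const_nhds
  rw [VectorField.lieBracket, ← hXX'.fderiv_eq, ← hXX'.eq_of_nhds]
  exact h3

end Bracket

/-! ### Gradient fields, the transposed Jacobian and traces -/

section Gradients

open Set Filter Topology

variable {D d : ℕ} {Ω : Set (EucSp D)} {φ : EucSp D → EucSp d}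

theorem inner_gradient_eq_fderiv (f : EucSp D → ℝ) (θ u : EucSp D) :
    inner ℝ (gradient f θ) u = fderiv ℝ f θ u := by
  rw [← InnerProductSpace.toDual_apply_apply (𝕜 := ℝ), toDual_gradient]

theorem contDiffOn_gradient {f : EucSp D → ℝ} (hΩ : IsOpen Ω) (hf : ContDiffOn ℝ ∞ f Ω) :
    ContDiffOn ℝ ∞ (gradient f) Ω := by
  rw [contDiffOn_euclidean]
  intro j
  have h1 : ContDiffOn ℝ ∞ (fderiv ℝ f) Ω := hf.fderiv_of_isOpen hΩ (by simp)
  have h2 : ∀ θ, gradient f θ j = fderiv ℝ f θ (EuclideanSpace.single j 1) := fun θ => by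
    rw [← inner_gradient_eq_fderiv, EuclideanSpace.inner_single_right]
    simp
  simp only [h2]
  exact h1.clm_apply contDiffOn_const

theorem ContDiffOn.component (hφ : ContDiffOn ℝ ∞ φ Ω) (i : Fin d) :
    ContDiffOn ℝ ∞ (fun θ => φ θ i) Ω :=
  contDiffOn_euclidean.1 hφ i

theorem fderiv_component {θ : EucSp D} (hφ : DifferentiableAt ℝ φ θ) (i : Fin d) (u : EucSp D) :
    fderiv ℝ (fun θ => φ θ i) θ u = fderiv ℝ φ θ u i := by
  have h1 : HasFDerivAt (fun θ => φ θ i)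
      ((EuclideanSpace.proj i : EucSp d →L[ℝ] ℝ).comp (fderiv ℝ φ θ)) θ :=
    (EuclideanSpace.proj i : EucSp d →L[ℝ] ℝ).hasFDerivAt.comp θ hφ.hasFDerivAt
  rw [h1.fderiv]
  rfl

theorem fderiv_eq_zero_iff_inner {θ : EucSp D} (hφ : DifferentiableAt ℝ φ θ) (u : EucSp D) :
    fderiv ℝ φ θ u = 0 ↔ ∀ i, inner ℝ (gradient (fun θ => φ θ i) θ) u = 0 := by
  simp only [inner_gradient_eq_fderiv, fderiv_component hφ]
  exact ⟨fun h i => by rw [h]; rfl, fun h => by ext i; exact h i⟩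

/-- Both sides express orthogonality of `∇f` to every `∇φᵢ`, by symmetry of the inner product. -/
theorem fderiv_gradient_eq_zero_iff {θ : EucSp D} (hφ : DifferentiableAt ℝ φ θ)
    (f : EucSp D → ℝ) : fderiv ℝ φ θ (gradient f θ) = 0 ↔
      ∀ i, fderiv ℝ f θ (gradient (fun θ => φ θ i) θ) = 0 := by
  rw [fderiv_eq_zero_iff_inner hφ]
  simp only [← inner_gradient_eq_fderiv f, real_inner_comm]

/-- The transposed Jacobian `a ↦ ∑ aᵢ ∇φᵢ(θ)`. -/
noncomputable def gradientMap (φ : EucSp D → EucSp d) (θ : EucSp D) : EucSp d →L[ℝ] EucSp D :=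
  ∑ i, (EuclideanSpace.proj i : EucSp d →L[ℝ] ℝ).smulRight (gradient (fun θ => φ θ i) θ)

theorem gradientMap_apply (φ : EucSp D → EucSp d) (θ : EucSp D) (a : EucSp d) :
    gradientMap φ θ a = ∑ i, a i • gradient (fun θ => φ θ i) θ := by
  simp [gradientMap]

theorem gradientMap_single (φ : EucSp D → EucSp d) (θ : EucSp D) (i : Fin d) :
    gradientMap φ θ (EuclideanSpace.single i 1) = gradient (fun θ => φ θ i) θ := by
  rw [gradientMap_apply, Finset.sum_eq_single i]
  · simp
  · intro j _ hj
    simp [hj]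
  · simp

theorem contDiffOn_gradientMap (hΩ : IsOpen Ω) (hφ : ContDiffOn ℝ ∞ φ Ω) :
    ContDiffOn ℝ ∞ (gradientMap φ) Ω := by
  have h1 : gradientMap φ = fun θ => ∑ i, ContinuousLinearMap.smulRightL ℝ (EucSp d) (EucSp D)
      (EuclideanSpace.proj i : EucSp d →L[ℝ] ℝ) (gradient (fun θ => φ θ i) θ) := rfl
  rw [h1]
  exact ContDiffOn.sum fun i _ =>
    (ContinuousLinearMap.contDiff _).comp_contDiffOn (contDiffOn_gradient hΩ (hφ.component i))

theorem gradientMap_mem_gradientSpan (φ : EucSp D → EucSp d) (a : EucSp d) :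
    (fun θ => gradientMap φ θ a) ∈ gradientSpan φ := by
  have h1 : (fun θ => gradientMap φ θ a) = ∑ i, a i • gradient (fun θ => φ θ i) := by
    ext1 θ
    rw [gradientMap_apply, Finset.sum_apply]
    rfl
  rw [h1]
  exact Submodule.sum_mem _ fun i _ =>
    Submodule.smul_mem _ _ (Submodule.subset_span (mem_range_self i))

theorem fieldTrace_gradientSpan (φ : EucSp D → EucSp d) (θ : EucSp D) :
    fieldTrace (gradientSpan φ : Set (EucSp D → EucSp D)) θ =
      LinearMap.range (gradientMap φ θ : EucSp d →ₗ[ℝ] EucSp D) := by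
  apply le_antisymm
  · refine Submodule.span_le.2 ?_
    rintro _ ⟨X, hX, rfl⟩
    have h1 : gradientSpan φ ≤ Submodule.comap (LinearMap.proj θ)
        (LinearMap.range (gradientMap φ θ : EucSp d →ₗ[ℝ] EucSp D)) := by
      refine Submodule.span_le.2 ?_
      rintro _ ⟨i, rfl⟩
      exact ⟨EuclideanSpace.single i 1, gradientMap_single φ θ i⟩
    exact h1 hX
  · rintro _ ⟨a, rfl⟩
    exact Submodule.subset_span ⟨_, gradientMap_mem_gradientSpan φ a, rfl⟩

theorem inner_gradientMap_eq_zero {θ u : EucSp D} (hφ : DifferentiableAt ℝ φ θ)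
    (hu : fderiv ℝ φ θ u = 0) (a : EucSp d) : inner ℝ (gradientMap φ θ a) u = 0 := by
  rw [fderiv_eq_zero_iff_inner hφ] at hu
  rw [gradientMap_apply, sum_inner]
  simp [inner_smul_left, hu]

theorem subset_generatedLieAlgebra (Ω : Set (EucSp D)) (W : Set (EucSp D → EucSp D)) :
    W ⊆ generatedLieAlgebra Ω W := by
  intro X hX
  simp only [generatedLieAlgebra, SetLike.mem_coe, Submodule.mem_sInf]
  exact fun S hS => hS.1 hX

theorem isBracketStable_generatedLieAlgebra (Ω : Set (EucSp D)) (W : Set (EucSp D → EucSp D)) :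
    IsBracketStable (generatedLieAlgebra Ω W) := by
  intro X hX Y hY
  simp only [generatedLieAlgebra, Submodule.mem_sInf] at hX hY ⊢
  exact fun S hS => hS.2.2 X (hX S hS) Y (hY S hS)

end Gradients

/-! ### From conservation laws to the Frobenius property -/

section LawsToFrobenius

open Set Filter Topology

variable {D d : ℕ} {Ω : Set (EucSp D)} {φ : EucSp D → EucSp d}

/-- The fields that are smooth on `Ω` and, on `U`, annihilate the components of `h`. -/
def annihilatingFields {N : ℕ} (Ω U : Set (EucSp D)) (h : EucSp D → EucSp N) :
    Submodule ℝ (EucSp D → EucSp D) where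
  carrier := {X | ContDiffOn ℝ ∞ X Ω ∧ ∀ θ ∈ U, ∀ j, fderiv ℝ (fun θ => h θ j) θ (X θ) = 0}
  add_mem' hX hY := ⟨hX.1.add hY.1, fun θ hθ j => by
    rw [Pi.add_apply, map_add, hX.2 θ hθ j, hY.2 θ hθ j, add_zero]⟩
  zero_mem' := ⟨contDiffOn_const, fun _ _ _ => map_zero _⟩
  smul_mem' c _ hX := ⟨hX.1.const_smul c, fun θ hθ j => by
    rw [Pi.smul_apply, map_smul, hX.2 θ hθ j, smul_zero]⟩

theorem isBracketStable_annihilatingFields {N : ℕ} {U : Set (EucSp D)} {h : EucSp D → EucSp N}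
    (hΩ : IsOpen Ω) (hU : IsOpen U) (hUΩ : U ⊆ Ω)
    (hh : ∀ j, ContDiffOn ℝ 1 (fun θ => h θ j) U) :
    IsBracketStable (annihilatingFields Ω U h) := by
  intro X hX Z hZ
  refine ⟨isBracketStable_smoothFields hΩ X hX.1 Z hZ.1, fun θ hθ j => ?_⟩
  have hn : Ω ∈ 𝓝 θ := hΩ.mem_nhds (hUΩ hθ)
  refine fderiv_lieBracket_eq_zero ((hX.1.contDiffAt hn).of_le (by simp))
    ((hZ.1.contDiffAt hn).of_le (by simp)) ((hh j).contDiffAt (hU.mem_nhds hθ)) ?_ ?_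
  · filter_upwards [hU.mem_nhds hθ] with x hx using hX.2 x hx j
  · filter_upwards [hU.mem_nhds hθ] with x hx using hZ.2 x hx j

theorem HasKernelTrivializingLaws.frobeniusProperty (hΩ : IsOpen Ω) (hφ : ContDiffOn ℝ ∞ φ Ω)
    (H : HasKernelTrivializingLaws φ Ω) : FrobeniusProperty φ Ω := by
  intro θ₀ hθ₀
  obtain ⟨U, hU, hθU, hUΩ, N, h, hlaw, hker⟩ := H θ₀ hθ₀
  have hφd : ∀ θ ∈ Ω, DifferentiableAt ℝ φ θ := fun θ hθ =>
    (hφ.contDiffAt (hΩ.mem_nhds hθ)).differentiableAt (by simp)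
  have hW : gradientSpan φ ≤ annihilatingFields Ω U h := by
    refine Submodule.span_le.2 ?_
    rintro _ ⟨i, rfl⟩
    exact ⟨contDiffOn_gradient hΩ (hφ.component i), fun θ hθ j =>
      (fderiv_gradient_eq_zero_iff (hφd θ (hUΩ hθ)) _).1 ((hlaw j).2 θ hθ) i⟩
  have hLie : generatedLieAlgebra Ω (gradientSpan φ : Set (EucSp D → EucSp D)) ≤
      annihilatingFields Ω U h :=
    sInf_le ⟨hW, fun X hX => hX.1,
      isBracketStable_annihilatingFields hΩ hU hUΩ fun j => (hlaw j).1⟩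
  have hhd : DifferentiableAt ℝ h θ₀ := differentiableAt_euclidean.2 fun j =>
    ((hlaw j).1.contDiffAt (hU.mem_nhds hθU)).differentiableAt one_ne_zero
  have hZ : ∀ X ∈ annihilatingFields Ω U h, fderiv ℝ h θ₀ (X θ₀) = 0 := fun X hX => by
    ext j
    rw [← fderiv_component hhd]
    exact hX.2 θ₀ hθU j
  apply le_antisymm
  · refine Submodule.span_le.2 ?_
    rintro _ ⟨X, hX, rfl⟩
    rw [fieldTrace_gradientSpan]
    set R := LinearMap.range (gradientMap φ θ₀ : EucSp d →ₗ[ℝ] EucSp D) with hR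
    -- The orthogonal complement of the gradient trace is `ker ∂φ(θ₀)`, so the hypothesis at `θ₀`
    -- itself eliminates `w'`.
    obtain ⟨w, hw, w', hw', hsum⟩ := R.exists_add_mem_mem_orthogonal (X θ₀)
    have h1 : fderiv ℝ φ θ₀ w' = 0 := by
      rw [fderiv_eq_zero_iff_inner (hφd θ₀ hθ₀)]
      intro i
      exact hw' _ ⟨EuclideanSpace.single i 1, gradientMap_single φ θ₀ i⟩
    have h2 : fderiv ℝ h θ₀ w = 0 := by
      obtain ⟨a, rfl⟩ := hw
      exact hZ _ (hW (gradientMap_mem_gradientSpan φ a))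
    have h3 : fderiv ℝ h θ₀ w' = 0 := by
      have h4 := hZ X (hLie hX)
      rwa [hsum, map_add, h2, zero_add] at h4
    have h5 : w' ∈ (⊥ : Submodule ℝ (EucSp D)) := by
      rw [← hker θ₀ hθU rfl]
      exact ⟨h1, h3⟩
    rw [Submodule.mem_bot] at h5
    change X θ₀ ∈ R
    rw [hsum, h5, add_zero]
    exact hw
  · exact Submodule.span_mono (image_mono (subset_generatedLieAlgebra _ _))

end LawsToFrobenius

/-! ### From constant rank and the Frobenius property to conservation laws -/

section FrobeniusToLaws

open Set Filter Topology

variable {D d : ℕ} {Ω : Set (EucSp D)} {φ : EucSp D → EucSp d}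

/-- The vector is the bracket at `θ` of the fields `gradientMap φ · a` and `gradientMap φ · b`,
which belong to the generated Lie algebra. -/
theorem FrobeniusProperty.bracket_mem_range (hΩ : IsOpen Ω) (hφ : ContDiffOn ℝ ∞ φ Ω)
    (H : FrobeniusProperty φ Ω) {θ : EucSp D} (hθ : θ ∈ Ω) (a b : EucSp d) :
    fderiv ℝ (gradientMap φ) θ (gradientMap φ θ a) b -
      fderiv ℝ (gradientMap φ) θ (gradientMap φ θ b) a ∈
        LinearMap.range (gradientMap φ θ : EucSp d →ₗ[ℝ] EucSp D) := by
  have hG : DifferentiableAt ℝ (gradientMap φ) θ :=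
    ((contDiffOn_gradientMap hΩ hφ).contDiffAt (hΩ.mem_nhds hθ)).differentiableAt (by simp)
  have h1 : ∀ c δ, fderiv ℝ (fun x => gradientMap φ x c) θ δ = fderiv ℝ (gradientMap φ) θ δ c :=
    fun c δ => by
      have h2 := hG.hasFDerivAt.clm_apply (hasFDerivAt_const c θ)
      rw [h2.fderiv]
      simp
  have h3 := isBracketStable_generatedLieAlgebra Ω (gradientSpan φ : Set (EucSp D → EucSp D))
    _ (subset_generatedLieAlgebra _ _ (gradientMap_mem_gradientSpan φ a))
    _ (subset_generatedLieAlgebra _ _ (gradientMap_mem_gradientSpan φ b))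
  rw [← fieldTrace_gradientSpan, ← H θ hθ]
  refine Submodule.subset_span ⟨_, h3, ?_⟩
  simp only [VectorField.lieBracket, h1]

/-- Near each point, an involutive gradient span of constant rank is spanned by commuting fields
that are linearly independent at the point. -/
theorem FrobeniusProperty.exists_commuting_frame (hΩ : IsOpen Ω) (hφ : ContDiffOn ℝ ∞ φ Ω)
    (H : FrobeniusProperty φ Ω) (hr : ConstantTraceDimension φ Ω) {θ₀ : EucSp D} (hθ₀ : θ₀ ∈ Ω) :
    ∃ (W : Submodule ℝ (EucSp D)) (B : EucSp D → W →L[ℝ] EucSp D),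
      ContDiffAt ℝ 1 B θ₀ ∧ (∀ v, B θ₀ v = v) ∧ (∀ᶠ θ in 𝓝 θ₀, CommutesAt B θ) ∧
      ∀ᶠ θ in 𝓝 θ₀, LinearMap.range (B θ).toLinearMap =
        LinearMap.range (gradientMap φ θ : EucSp d →ₗ[ℝ] EucSp D) := by
  set W := LinearMap.range (gradientMap φ θ₀ : EucSp d →ₗ[ℝ] EucSp D) with hW
  obtain ⟨T', hT'⟩ := LinearMap.exists_rightInverse_of_surjective
    (gradientMap φ θ₀ : EucSp d →ₗ[ℝ] EucSp D).rangeRestrict (LinearMap.range_rangeRestrict _)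
  let T : W →L[ℝ] EucSp d := LinearMap.toContinuousLinearMap T'
  have hT : ∀ w, gradientMap φ θ₀ (T w) = w := fun w =>
    congrArg Subtype.val (LinearMap.congr_fun hT' w)
  let P : EucSp D →L[ℝ] W := W.orthogonalProjectionOnto
  -- `T` is a section of the transposed Jacobian at `θ₀`, so `A θ₀ = 1` and `A` is invertible
  -- nearby. Multiplying by its inverse normalizes the frame to `P ∘ B = id`. The default value of
  -- `Ring.inverse` at non-units plays no role near `θ₀`.
  let A : EucSp D → W →L[ℝ] W := fun θ => P.comp ((gradientMap φ θ).comp T)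
  let C : EucSp D → W →L[ℝ] W := fun θ => Ring.inverse (A θ)
  let B : EucSp D → W →L[ℝ] EucSp D := fun θ => (gradientMap φ θ).comp (T.comp (C θ))
  have hA0 : A θ₀ = 1 := by
    refine ContinuousLinearMap.ext fun w => ?_
    change P (gradientMap φ θ₀ (T w)) = w
    rw [hT]
    exact Submodule.orthogonalProjectionOnto_mem_subspace_eq_self w
  have hG : ∀ θ ∈ Ω, ContDiffAt ℝ 1 (gradientMap φ) θ := fun θ hθ =>
    ((contDiffOn_gradientMap hΩ hφ).contDiffAt (hΩ.mem_nhds hθ)).of_le (by simp)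
  have hA : ∀ θ ∈ Ω, ContDiffAt ℝ 1 A θ := fun θ hθ =>
    contDiffAt_const.clm_comp ((hG θ hθ).clm_comp contDiffAt_const)
  have hC : ∀ θ ∈ Ω, IsUnit (A θ) → ContDiffAt ℝ 1 C θ := fun θ hθ ⟨u, hu⟩ => by
    have h1 : ContDiffAt ℝ 1 Ring.inverse (A θ) := by
      rw [← hu]
      exact contDiffAt_ringInverse (R := W →L[ℝ] W) ℝ u
    exact h1.comp θ (hA θ hθ)
  have hTC : ∀ θ ∈ Ω, IsUnit (A θ) → ContDiffAt ℝ 1 (fun θ => T.comp (C θ)) θ := fun θ hθ hu =>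
    contDiffAt_const.clm_comp (hC θ hθ hu)
  have hB : ∀ θ ∈ Ω, IsUnit (A θ) → ContDiffAt ℝ 1 B θ := fun θ hθ hu =>
    (hG θ hθ).clm_comp (hTC θ hθ hu)
  have hunit : ∀ᶠ θ in 𝓝 θ₀, IsUnit (A θ) :=
    (hA θ₀ hθ₀).continuousAt.eventually
      ((Units.isOpen (R := W →L[ℝ] W)).mem_nhds (hA0 ▸ isUnit_one))
  have hPB : ∀ θ, IsUnit (A θ) → P.comp (B θ) = ContinuousLinearMap.id ℝ W := fun θ hu =>
    Ring.mul_inverse_cancel (A θ) hu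
  have hrange : ∀ θ ∈ Ω, IsUnit (A θ) → LinearMap.range (B θ : W →ₗ[ℝ] EucSp D) =
      LinearMap.range (gradientMap φ θ : EucSp d →ₗ[ℝ] EucSp D) := fun θ hθ hu => by
    obtain ⟨r, hr⟩ := hr
    -- `B θ` is injective, so its rank is the rank at `θ₀`; constancy of the rank turns the
    -- inclusion into an equality.
    apply Submodule.eq_of_le_of_finrank_eq
    · rintro _ ⟨w, rfl⟩
      exact ⟨T (C θ w), rfl⟩
    · have hinj : Function.Injective (B θ : W →ₗ[ℝ] EucSp D) := by
        intro v w hvw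
        have h1 := congrArg P hvw
        have h2 := fun z => congrArg (fun S : W →L[ℝ] W => S z) (hPB θ hu)
        exact (h2 v).symm.trans (h1.trans (h2 w))
      rw [LinearMap.finrank_range_of_inj hinj, hW, ← fieldTrace_gradientSpan,
        ← fieldTrace_gradientSpan, hr θ hθ, hr θ₀ hθ₀]
  refine ⟨W, B, hB θ₀ hθ₀ (hA0 ▸ isUnit_one), fun v => ?_, ?_, ?_⟩
  · have h1 : C θ₀ = 1 := by
      change Ring.inverse (A θ₀) = 1
      rw [hA0, Ring.inverse_one]
    change gradientMap φ θ₀ (T (C θ₀ v)) = v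
    rw [h1]
    exact hT v
  · filter_upwards [hΩ.mem_nhds hθ₀, hunit.eventually_nhds] with θ hθ hun v w
    have hu := hun.self_of_nhds
    have hBd := ((hB θ hθ hu).differentiableAt one_ne_zero).hasFDerivAt
    have hK := ((hTC θ hθ hu).differentiableAt one_ne_zero).hasFDerivAt
    have hGd := ((hG θ hθ).differentiableAt one_ne_zero).hasFDerivAt
    -- `P ∘ B` is locally constant, so `P` kills every derivative of `B`, and hence every bracket of
    -- frame fields.
    have hPz : ∀ δ z, P (fderiv ℝ B θ δ z) = 0 := fun δ z => by
      have hz : HasFDerivAt (fun x => B x z) ((ContinuousLinearMap.apply ℝ (EucSp D) z).comp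
          (fderiv ℝ B θ)) θ :=
        HasFDerivAt.comp (g := fun S : W →L[ℝ] EucSp D => S z) θ
          (ContinuousLinearMap.apply ℝ (EucSp D) z).hasFDerivAt hBd
      have h1 : HasFDerivAt (fun x => P (B x z)) (P.comp ((ContinuousLinearMap.apply ℝ _ z).comp
          (fderiv ℝ B θ))) θ :=
        P.hasFDerivAt.comp θ hz
      have h2 : (fun x => P (B x z)) =ᶠ[𝓝 θ] fun _ => z := by
        filter_upwards [hun] with x hx
        exact congrArg (fun S : W →L[ℝ] W => S z) (hPB x hx)
      have h3 := (h1.congr_of_eventuallyEq h2.symm).unique (hasFDerivAt_const z θ)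
      exact congrArg (fun S : EucSp D →L[ℝ] W => S δ) h3
    have hprod : ∀ δ z, fderiv ℝ B θ δ z =
        gradientMap φ θ (fderiv ℝ (fun θ => T.comp (C θ)) θ δ z) +
          fderiv ℝ (gradientMap φ) θ δ (T (C θ z)) := fun δ z => by
      rw [(hGd.clm_comp hK).fderiv]
      simp
    -- Derivatives of the coefficients `T ∘ C` contribute only vectors in the gradient trace. What
    -- remains is a bracket of gradient combinations with coefficients frozen at `θ`.
    have hmem : fderiv ℝ B θ (B θ v) w - fderiv ℝ B θ (B θ w) v ∈
        LinearMap.range (B θ : W →ₗ[ℝ] EucSp D) := by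
      rw [hrange θ hθ hu, hprod, hprod, add_sub_add_comm]
      exact Submodule.add_mem _ (Submodule.sub_mem _ ⟨_, rfl⟩ ⟨_, rfl⟩)
        (H.bracket_mem_range hΩ hφ hθ (T (C θ v)) (T (C θ w)))
    obtain ⟨z, hz⟩ := hmem
    have h1 := congrArg P hz
    rw [map_sub, hPz, hPz, sub_zero] at h1
    have h2 : z = 0 := (congrArg (fun S : W →L[ℝ] W => S z) (hPB θ hu)).symm.trans h1
    rw [h2, map_zero] at hz
    exact sub_eq_zero.1 hz.symm
  · filter_upwards [hΩ.mem_nhds hθ₀, hunit] with θ hθ hu using hrange θ hθ hu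

theorem FrobeniusProperty.hasKernelTrivializingLaws (hΩ : IsOpen Ω) (hφ : ContDiffOn ℝ ∞ φ Ω)
    (H : FrobeniusProperty φ Ω) (hr : ConstantTraceDimension φ Ω) :
    HasKernelTrivializingLaws φ Ω := by
  intro θ₀ hθ₀
  obtain ⟨W, B, hB, hB0, hcomm, hrange⟩ := H.exists_commuting_frame hΩ hφ hr hθ₀
  let e : (W × Wᗮ) ≃L[ℝ] EucSp D := (Submodule.prodEquivOfIsCompl W Wᗮ
    (Submodule.isCompl_orthogonal W)).toContinuousLinearEquiv
  obtain ⟨h, hh, hh'⟩ := exists_firstIntegrals hB hcomm e fun v => by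
    rw [hB0]
    simp [e]
  obtain ⟨U, hU, hUo, hθU⟩ := eventually_nhds_iff.1 (((hh.eventually (by simp)).and hh').and
    (hrange.and (hΩ.mem_nhds hθ₀)))
  have hφd : ∀ θ ∈ U, DifferentiableAt ℝ φ θ := fun θ hθ =>
    (hφ.contDiffAt (hΩ.mem_nhds (hU θ hθ).2.2)).differentiableAt (by simp)
  have hhd : ∀ θ ∈ U, HasFDerivAt (fun θ => (h θ : EucSp D))
      (Wᗮ.subtypeL.comp (fderiv ℝ h θ)) θ := fun θ hθ =>
    Wᗮ.subtypeL.hasFDerivAt.comp θ ((hU θ hθ).1.1.differentiableAt one_ne_zero).hasFDerivAt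
  -- The first integrals take values in `Wᗮ`; reading them in the ambient space gives `N = D` laws,
  -- possibly redundant. The kernel condition holds on all of `U`, so the level-set restriction is
  -- dropped.
  refine ⟨U, hUo, hθU, fun θ hθ => (hU θ hθ).2.2, D, fun θ => (h θ : EucSp D), fun j => ⟨?_, ?_⟩,
    fun θ hθ _ => ?_⟩
  · intro θ hθ
    have h1 : ContDiffAt ℝ 1 (fun θ => (h θ : EucSp D)) θ :=
      Wᗮ.subtypeL.contDiff.contDiffAt.comp θ (hU θ hθ).1.1
    exact (contDiffAt_euclidean.1 h1 j).contDiffWithinAt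
  · intro θ hθ
    rw [fderiv_gradient_eq_zero_iff (hφd θ hθ)]
    intro i
    have h1 : gradient (fun θ => φ θ i) θ ∈ LinearMap.range (B θ : W →ₗ[ℝ] EucSp D) := by
      rw [(hU θ hθ).2.1]
      exact ⟨EuclideanSpace.single i 1, gradientMap_single φ θ i⟩
    obtain ⟨v, hv⟩ := h1
    have h2 : fderiv ℝ h θ (gradient (fun θ => φ θ i) θ) = 0 := by
      rw [← hv]
      exact (hU θ hθ).1.2.1 v
    rw [fderiv_component (hhd θ hθ).differentiableAt, (hhd θ hθ).fderiv]
    simp [h2]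
  · rw [Submodule.eq_bot_iff]
    rintro u ⟨hu1, hu2⟩
    have h1 : (fderiv ℝ h θ u : EucSp D) = 0 := by
      have h2 : fderiv ℝ (fun θ => (h θ : EucSp D)) θ u = 0 := hu2
      rw [(hhd θ hθ).fderiv] at h2
      exact h2
    obtain ⟨v, hv⟩ := (hU θ hθ).1.2.2 u (Subtype.ext h1)
    have h3 : u ∈ LinearMap.range (B θ : W →ₗ[ℝ] EucSp D) := ⟨v, hv.symm⟩
    rw [(hU θ hθ).2.1] at h3
    obtain ⟨a, ha⟩ := h3
    -- `u` lies both in the gradient trace and in its orthogonal complement `ker ∂φ(θ)`, hence is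
    -- orthogonal to itself.
    have h4 := inner_gradientMap_eq_zero (hφd θ hθ) hu1 a
    have h5 : gradientMap φ θ a = u := ha
    rw [h5] at h4
    exact inner_self_eq_zero.1 h4

end FrobeniusToLaws

theorem mainTheorem9 {D d : ℕ} (φ : EucSp D → EucSp d) (Ω : Set (EucSp D)) (hΩ : IsOpen Ω)
    (hφ : ContDiffOn ℝ ∞ φ Ω) :
    (FrobeniusProperty φ Ω ∧ ConstantTraceDimension φ Ω → HasKernelTrivializingLaws φ Ω) ∧
    (HasKernelTrivializingLaws φ Ω → FrobeniusProperty φ Ω) :=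
  ⟨fun h => h.1.hasKernelTrivializingLaws hΩ hφ h.2, fun h => h.frobeniusProperty hΩ hφ⟩
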